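/- Fix $1 \ge p > q > z > 0$. For $N \ge 2$ let $G$ be the random undirected graph (self-edges allowed) on $2N$ nodes, $N$ of class $0$ and $N$ of class $1$, in which the unordered pairs of (not necessarily distinct) nodes are edges independently, with probability $p$ for a pair inside class $0$, $q$ for a pair inside class $1$, and $z$ for a pair of nodes of different classes. Let $v$ be a node chosen uniformly at random, independently of $G$. Write $Y(v)$ for the class of a node $v$ and $Y(S)$ for the strict majority class of a set $S$ of nodes (a tie has no majority class, and counts as different from both classes). Let $E_{k,v}(G)$ be the $k$-ego network of $v$, i.e. the set of nodes at shortest-path distance at most $k$ from $v$. Let $L = I - D^{-1/2} A D^{-1/2}$ be the normalized Laplacian of $G$, where $A$ is the adjacency matrix and $D$ the diagonal matrix of its row sums (with $0^{-1/2} := 0$). For every graph $G$ choose an orthonormal basis of eigenvectors of $L$, listed in ascending order of the eigenvalues; let $\lambda_2(v), \lambda_3(v)$ be the entries at $v$ of the second and of the third eigenvector, and $\lambda(v) = (\lambda_2(v), \lambda_3(v)) \in \mathbb{R}^2$. For $\epsilon > 0$ let the spectral crop be $C_\epsilon(v) = \{ v' : \|\lambda(v') - \lambda(v)\| \le \epsilon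 \}$, with the Euclidean norm. Then there are a constant $c > 0$, an integer $k_{\max} \ge 1$ and a function $f$ with $f(N) \to 0$ as $N \to \infty$, which depend only on $p, q, z$, such that for every $N \ge 2$ and every choice of the eigenbases, with $\epsilon = c/\sqrt{N}$, the following holds with probability at least $1 - f(N)$ over $(G, v)$: $$ Y(E_{k,v}(G)) = Y(C_\epsilon(v)) = Y(v) \quad \text{for all integers } 0 \le k \le k_{\max}. $$ -/

import Mathlib

namespace SBM

open MeasureTheory ProbabilityTheory Matrix

/-- The `2N` nodes: the node `(c, i)` is the `i`-th node of class `c`, for `c = 0, 1`. -/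
abbrev Node (N : ℕ) : Type := Fin 2 × Fin N

/-- The class `Y(v)` of a node. -/
def label {N : ℕ} (v : Node N) : Fin 2 := v.1

/-- An undirected graph on the `2N` nodes, possibly with self-edges: for every unordered pair of
nodes (a diagonal pair being a self-edge), whether it is an edge. -/
abbrev Graph (N : ℕ) : Type := Sym2 (Node N) → Bool

/-- The probability that an unordered pair of nodes is an edge: `p` inside class `0`, `q` inside
class `1`, `z` between the classes. -/
def edgeProb {N : ℕ} (p q z : unitInterval) : Sym2 (Node N) → unitInterval :=
  Sym2.lift ⟨fun u w => if label u = label w then (if label u = 0 then p else q) else z, by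
    intro u w
    by_cases h : label u = label w
    · simp [h]
    · simp [h, Ne.symm h]⟩

/-- The law of the two-block stochastic block model on `2N` nodes: the edge indicators of distinct
unordered pairs of nodes are independent Bernoulli variables with parameters `edgeProb p q z`. -/
noncomputable def law (N : ℕ) (p q z : unitInterval) : Measure (Graph N) :=
  Measure.pi fun e => bernoulliMeasure true false (edgeProb p q z e)

/-- The joint law of the random graph and an independent, uniformly chosen node. -/
noncomputable def jointLaw (N : ℕ) (p q z : unitInterval) : Measure (Graph N × Node N) :=
  (law N p q z).prod (uniformOn Set.univ)

/-- The adjacency matrix. -/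
def adj {N : ℕ} (G : Graph N) : Matrix (Node N) (Node N) ℝ :=
  Matrix.of fun u w => if G s(u, w) then 1 else 0

/-- The degree of a node: the row sum of the adjacency matrix. -/
def degree {N : ℕ} (G : Graph N) (u : Node N) : ℝ := ∑ w, adj G u w

/-- The diagonal matrix `D ^ (-1/2)`, with entry `0` at a node of degree `0`. -/
noncomputable def invSqrtDegree {N : ℕ} (G : Graph N) : Matrix (Node N) (Node N) ℝ :=
  Matrix.diagonal fun u => (√(degree G u))⁻¹

/-- The (normalized) Laplacian `I - D ^ (-1/2) A D ^ (-1/2)`. -/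
noncomputable def laplacian {N : ℕ} (G : Graph N) : Matrix (Node N) (Node N) ℝ :=
  1 - invSqrtDegree G * adj G * invSqrtDegree G

/-- A complete orthonormal system of eigenvectors of the Laplacian of `G`, listed (from index `0`)
in ascending order of the eigenvalues. -/
structure Eigensystem {N : ℕ} (G : Graph N) where
  /-- the eigenvalues -/
  value : Fin (2 * N) → ℝ
  /-- the eigenvectors -/
  vector : OrthonormalBasis (Fin (2 * N)) ℝ (EuclideanSpace ℝ (Node N))
  monotone_value : Monotone value
  mulVec_vector : ∀ j, laplacian G *ᵥ ⇑(vector j) = value j • ⇑(vector j)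

/-- The coordinates `(λ₂(v), λ₃(v))` of a node under the second and the third eigenvector. -/
noncomputable def Eigensystem.coords {N : ℕ} {G : Graph N} (S : Eigensystem G) (hN : 2 ≤ N)
    (v : Node N) : EuclideanSpace ℝ (Fin 2) :=
  !₂[S.vector ⟨1, by lia⟩ v, S.vector ⟨2, by lia⟩ v]

open Classical in
/-- The node set of the spectral crop `C_ε(v)`. -/
noncomputable def crop {N : ℕ} {G : Graph N} (S : Eigensystem G) (hN : 2 ≤ N) (ε : ℝ)
    (v : Node N) : Finset (Node N) :=
  {w | ‖S.coords hN w - S.coords hN v‖ ≤ ε}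

/-- The simple graph underlying `G` (self-edges do not matter for distances). -/
def simple {N : ℕ} (G : Graph N) : SimpleGraph (Node N) where
  Adj u w := u ≠ w ∧ G s(u, w) = true
  symm := ⟨fun u w h => ⟨h.1.symm, by rw [Sym2.eq_swap]; exact h.2⟩⟩
  loopless := ⟨fun _ h => h.1 rfl⟩

open Classical in
/-- The node set of the `k`-ego network `E_{k,v}(G)`: the nodes at shortest-path distance at most
`k` from `v` (the distance is `⊤` between different connected components). -/
noncomputable def ego {N : ℕ} (G : Graph N) (k : ℕ) (v : Node N) : Finset (Node N) :=
  {w | (simple G).edist v w ≤ (k : ℕ∞)}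

/-- The majority label of a set of nodes: the label that strictly more than half of the nodes
carry, and `none` if there is a tie. -/
def majority {N : ℕ} (S : Finset (Node N)) : Option (Fin 2) :=
  let n₀ := (S.filter fun w => label w = 0).card
  let n₁ := (S.filter fun w => label w = 1).card
  if n₁ < n₀ then some 0 else if n₀ < n₁ then some 1 else none

end SBM

/-! The constants are `c = 1/2` and `kmax = 1`. The eigenvectors of `L` are those of `D^(-1/2) A
D^(-1/2)`, with the order of the eigenvalues reversed. Replacing `A` and `D` by their means gives
the rank-two matrix `e₁ e₁ᵀ + ρ e₂ e₂ᵀ` with `0 < ρ < 1`, where `√N e₂` takes one value per class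
and the two values differ by at least `1` (`meanNormalized_eq`, `one_le_abs_separator_sub`). With
high probability the noise has operator norm at most `δN` and all class degrees are within `δN` of
their means (`measure_not_isTypical_le`). The noise bound is a fourth moment estimate, the degree
bound is Hoeffding's inequality. Perturbation theory (`exists_sign_norm_sub_le`) then puts the
second eigenvector within squared distance `O(δ²)` of `± e₂`, so `√N λ₂` is close to its class value
outside a set of `O(δ²N)` nodes.

The third eigenvector belongs to the noise, and only its norm is used. Were a node's crop to contain
few nodes of its own class, the node would lie in a sparse cell of the `λ₃`-axis. Cutting that axis
into cells shows that few nodes do (`card_few_neighbours_le`). All other nodes see more well-placed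
nodes of their own class than there are badly placed nodes altogether, and only the latter can enter
the crop with the wrong label (`card_majority_crop_ne_le`).

For the ego networks, radius `0` is trivial and radius `1` compares about `qN` or `pN` neighbours of
the own class with about `zN` of the other (`IsTypical.majority_ego_one`). -/

namespace SBM

open MeasureTheory ProbabilityTheory Matrix
open scoped RealInnerProductSpace

/-! ### Perturbation of a rank-two operator -/

section Perturbation

variable {H : Type*} [NormedAddCommGroup H] [InnerProductSpace ℝ H] {e₁ e₂ x y : H} {ρ δ μ : ℝ}

lemma inner_sub_proj (he₁ : ‖e₁‖ = 1) (he₂ : ‖e₂‖ = 1) (he : ⟪e₁, e₂⟫ = 0) (x y : H) :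
    ⟪x - ⟪e₁, x⟫ • e₁ - ⟪e₂, x⟫ • e₂, y - ⟪e₁, y⟫ • e₁ - ⟪e₂, y⟫ • e₂⟫ =
      ⟪x, y⟫ - ⟪e₁, x⟫ * ⟪e₁, y⟫ - ⟪e₂, x⟫ * ⟪e₂, y⟫ := by
  have he' : ⟪e₂, e₁⟫ = 0 := by rw [real_inner_comm]; exact he
  simp only [inner_sub_left, inner_sub_right, inner_smul_left, inner_smul_right,
    real_inner_self_eq_norm_sq, he₁, he₂, he, he', real_inner_comm e₁ x, real_inner_comm e₂ x]
  simp only [RCLike.conj_to_real]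
  ring

lemma sq_norm_smul_sub_rankTwo (he₁ : ‖e₁‖ = 1) (he₂ : ‖e₂‖ = 1) (he : ⟪e₁, e₂⟫ = 0)
    (hx : ‖x‖ = 1) :
    ‖μ • x - (⟪e₁, x⟫ • e₁ + (ρ * ⟪e₂, x⟫) • e₂)‖ ^ 2 =
      (μ - 1) ^ 2 * ⟪e₁, x⟫ ^ 2 + (μ - ρ) ^ 2 * ⟪e₂, x⟫ ^ 2 +
        μ ^ 2 * (1 - ⟪e₁, x⟫ ^ 2 - ⟪e₂, x⟫ ^ 2) := by
  have he' : ⟪e₂, e₁⟫ = 0 := by rw [real_inner_comm]; exact he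
  rw [← real_inner_self_eq_norm_sq]
  simp only [inner_sub_left, inner_sub_right, inner_add_left, inner_add_right, inner_smul_left,
    inner_smul_right, real_inner_self_eq_norm_sq, he₁, he₂, he, he', hx,
    real_inner_comm e₁ x, real_inner_comm e₂ x]
  simp only [RCLike.conj_to_real]
  ring

lemma sq_inner_add_sq_inner_le (he₁ : ‖e₁‖ = 1) (he₂ : ‖e₂‖ = 1) (he : ⟪e₁, e₂⟫ = 0)
    (hx : ‖x‖ = 1) : ⟪e₁, x⟫ ^ 2 + ⟪e₂, x⟫ ^ 2 ≤ 1 := by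
  have h := inner_sub_proj he₁ he₂ he x x
  rw [real_inner_self_eq_norm_sq, real_inner_self_eq_norm_sq, hx] at h
  nlinarith [sq_nonneg ‖x - ⟪e₁, x⟫ • e₁ - ⟪e₂, x⟫ • e₂‖]

/-- Cauchy–Schwarz for the components of `x` and `y` orthogonal to the plane of `e₁, e₂`. As `x ⊥
y`, their inner product is minus that of the projections to the plane. -/
lemma mul_sub_sq_le (he₁ : ‖e₁‖ = 1) (he₂ : ‖e₂‖ = 1) (he : ⟪e₁, e₂⟫ = 0)
    (hx : ‖x‖ = 1) (hy : ‖y‖ = 1) (hxy : ⟪x, y⟫ = 0) :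
    (⟪e₁, x⟫ * ⟪e₁, y⟫ + ⟪e₂, x⟫ * ⟪e₂, y⟫) ^ 2 ≤
      (1 - ⟪e₁, x⟫ ^ 2 - ⟪e₂, x⟫ ^ 2) * (1 - ⟪e₁, y⟫ ^ 2 - ⟪e₂, y⟫ ^ 2) := by
  have h := real_inner_mul_inner_self_le (x - ⟪e₁, x⟫ • e₁ - ⟪e₂, x⟫ • e₂)
    (y - ⟪e₁, y⟫ • e₁ - ⟪e₂, y⟫ • e₂)
  simp only [inner_sub_proj he₁ he₂ he, real_inner_self_eq_norm_sq, hx, hy, hxy] at h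
  linarith

variable {ι : Type*} [Fintype ι] {b : OrthonormalBasis ι ℝ H} {T : H →ₗ[ℝ] H} {m : ι → ℝ}
  {i₀ i₁ : ι}

lemma inner_map_self_le (hT : ∀ j, T (b j) = m j • b j) (hm : ∀ j, j ≠ i₀ → m j ≤ m i₁)
    (hy : ⟪b i₀, y⟫ = 0) : ⟪y, T y⟫ ≤ m i₁ * ‖y‖ ^ 2 := by
  have hTy : T y = ∑ j, ⟪b j, y⟫ • (m j • b j) := by
    conv_lhs => rw [← b.sum_repr' y, map_sum]
    simp only [map_smul, hT]
  rw [hTy, inner_sum, ← b.sum_sq_inner_right y, Finset.mul_sum]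
  refine Finset.sum_le_sum fun j _ => ?_
  rw [inner_smul_right, inner_smul_right, real_inner_comm (b j) y]
  by_cases hj : j = i₀
  · subst hj; simp [hy]
  · nlinarith [hm j hj, sq_nonneg ⟪b j, y⟫]

/-- Courant–Fischer: the plane of `e₁, e₂` contains a nonzero vector orthogonal to `b i₀`. Its
Rayleigh quotient for `T` is at least `ρ - δ`, and at most `m i₁`. -/
lemma sub_le_second_eigenvalue (he₁ : ‖e₁‖ = 1) (he₂ : ‖e₂‖ = 1) (he : ⟪e₁, e₂⟫ = 0)
    (hρ : ρ ≤ 1) (hT : ∀ j, T (b j) = m j • b j) (hm : ∀ j, j ≠ i₀ → m j ≤ m i₁)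
    (hδ : ∀ x, ‖T x - (⟪e₁, x⟫ • e₁ + (ρ * ⟪e₂, x⟫) • e₂)‖ ≤ δ * ‖x‖) :
    ρ - δ ≤ m i₁ := by
  have he' : ⟪e₂, e₁⟫ = 0 := by rw [real_inner_comm]; exact he
  obtain ⟨s, t, hst, hy⟩ : ∃ s t : ℝ, 0 < s ^ 2 + t ^ 2 ∧ ⟪b i₀, s • e₁ + t • e₂⟫ = 0 := by
    by_cases h : ⟪b i₀, e₁⟫ = 0
    · exact ⟨1, 0, by norm_num, by simp [h]⟩
    · refine ⟨-⟪b i₀, e₂⟫, ⟪b i₀, e₁⟫, by positivity, ?_⟩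
      simp only [inner_add_right, inner_smul_right]; ring
  have h1 := inner_map_self_le (b := b) hT hm hy
  set y := s • e₁ + t • e₂ with hy_def
  have hn : ‖y‖ ^ 2 = s ^ 2 + t ^ 2 := by
    rw [← real_inner_self_eq_norm_sq, hy_def]
    simp only [inner_add_left, inner_add_right, inner_smul_left, inner_smul_right,
      real_inner_self_eq_norm_sq, he₁, he₂, he, he', RCLike.conj_to_real]
    ring
  have hy₁ : ⟪e₁, y⟫ = s := by
    simp [hy_def, inner_add_right, inner_smul_right, he₁, he]
  have hy₂ : ⟪e₂, y⟫ = t := by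
    simp [hy_def, inner_add_right, inner_smul_right, he₂, he']
  have h2 := (abs_le.1 ((abs_real_inner_le_norm y _).trans
    (mul_le_mul_of_nonneg_left (hδ y) (norm_nonneg y)))).1
  rw [inner_sub_right, inner_add_right, inner_smul_right, inner_smul_right, real_inner_comm e₁ y,
    real_inner_comm e₂ y, hy₁, hy₂] at h2
  have h3 : (ρ - δ) * (s ^ 2 + t ^ 2) ≤ m i₁ * (s ^ 2 + t ^ 2) := by
    have h4 : ‖y‖ * (δ * ‖y‖) = δ * (s ^ 2 + t ^ 2) := by rw [← hn]; ring
    rw [hn] at h1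
    linarith [mul_nonneg (sub_nonneg.2 hρ) (sq_nonneg s)]
  exact le_of_mul_le_mul_right h3 hst

/-- If `T` is a small perturbation of `e₁ e₁ᵀ + ρ e₂ e₂ᵀ` with `0 < ρ < 1`, then the second
eigenvector of `T` is close to `± e₂`. -/
theorem exists_sign_norm_sub_le (he₁ : ‖e₁‖ = 1) (he₂ : ‖e₂‖ = 1) (he : ⟪e₁, e₂⟫ = 0)
    (hρ₀ : 0 < ρ) (hρ : ρ < 1) (hT : ∀ j, T (b j) = m j • b j) (hne : i₀ ≠ i₁)
    (h₀₁ : m i₁ ≤ m i₀) (hm : ∀ j, j ≠ i₀ → m j ≤ m i₁)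
    (hδ : ∀ x, ‖T x - (⟪e₁, x⟫ • e₁ + (ρ * ⟪e₂, x⟫) • e₂)‖ ≤ δ * ‖x‖) (hδρ : δ ≤ ρ / 2)
    (hτ : 4 * δ ^ 2 * (1 / ρ ^ 2 + 1 / (1 - ρ) ^ 2) < 1 / 2) :
    ∃ s : ℝ, s ^ 2 = 1 ∧
      ‖b i₁ - s • e₂‖ ^ 2 ≤ 8 * δ ^ 2 * (1 / ρ ^ 2 + 1 / (1 - ρ) ^ 2) := by
  have hbn : ∀ j, ‖b j‖ = 1 := fun j => b.orthonormal.1 j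
  -- The perturbation bound tested on each eigenvector: a component of `b j` is small as soon as `m
  -- j` is away from the corresponding value `1`, `ρ` or `0`.
  have hkey : ∀ j, (m j - 1) ^ 2 * ⟪e₁, b j⟫ ^ 2 + (m j - ρ) ^ 2 * ⟪e₂, b j⟫ ^ 2 +
        m j ^ 2 * (1 - ⟪e₁, b j⟫ ^ 2 - ⟪e₂, b j⟫ ^ 2) ≤ δ ^ 2 := by
    intro j
    have h := hδ (b j)
    rw [hT, hbn, mul_one] at h
    rw [← sq_norm_smul_sub_rankTwo he₁ he₂ he (hbn j)]
    exact pow_le_pow_left₀ (norm_nonneg _) h 2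
  have hle := fun j => sq_inner_add_sq_inner_le he₁ he₂ he (hbn j)
  have hlow : ρ / 2 ≤ m i₁ := by
    linarith [sub_le_second_eigenvalue (b := b) he₁ he₂ he hρ.le hT hm hδ]
  have hρ' : 0 < 1 - ρ := by linarith
  have hperp : ∀ j, ρ / 2 ≤ m j →
      1 - ⟪e₁, b j⟫ ^ 2 - ⟪e₂, b j⟫ ^ 2 ≤ 4 * δ ^ 2 * (1 / ρ ^ 2) := by
    intro j hj
    have h1 : (ρ / 2) ^ 2 * (1 - ⟪e₁, b j⟫ ^ 2 - ⟪e₂, b j⟫ ^ 2) ≤ δ ^ 2 := by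
      have : (ρ / 2) ^ 2 ≤ m j ^ 2 := pow_le_pow_left₀ (by positivity) hj 2
      nlinarith [hkey j, hle j, sq_nonneg ((m j - 1) * ⟪e₁, b j⟫),
        sq_nonneg ((m j - ρ) * ⟪e₂, b j⟫)]
    rw [mul_one_div, le_div_iff₀ (by positivity)]
    linarith
  have hcomp : ∀ a k : ℝ, ((1 - ρ) / 2) ^ 2 ≤ k ^ 2 → k ^ 2 * a ^ 2 ≤ δ ^ 2 →
      a ^ 2 ≤ 4 * δ ^ 2 * (1 / (1 - ρ) ^ 2) := by
    intro a k hk h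
    rw [mul_one_div, le_div_iff₀ (by positivity)]
    nlinarith [sq_nonneg a]
  set τ := 4 * δ ^ 2 * (1 / ρ ^ 2 + 1 / (1 - ρ) ^ 2) with hτ_def
  have hτ' : τ = 4 * δ ^ 2 * (1 / ρ ^ 2) + 4 * δ ^ 2 * (1 / (1 - ρ) ^ 2) := by
    rw [hτ_def]; ring
  have hpart₁ : ∀ j, (m j - 1) ^ 2 * ⟪e₁, b j⟫ ^ 2 ≤ δ ^ 2 := fun j => by
    nlinarith [hkey j, hle j, mul_nonneg (sq_nonneg (m j)) (sub_nonneg.2 (hle j)),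
      sq_nonneg ((m j - ρ) * ⟪e₂, b j⟫)]
  have hpart₂ : ∀ j, (m j - ρ) ^ 2 * ⟪e₂, b j⟫ ^ 2 ≤ δ ^ 2 := fun j => by
    nlinarith [hkey j, hle j, mul_nonneg (sq_nonneg (m j)) (sub_nonneg.2 (hle j)),
      sq_nonneg ((m j - 1) * ⟪e₁, b j⟫)]
  -- Otherwise `m i₀` and `m i₁` are both far from `ρ` and `0`, so `b i₀` and `b i₁` are both mostly
  -- along `e₁`, against their orthogonality.
  have hup : m i₁ < (1 + ρ) / 2 := by
    by_contra! hcon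
    have hbig : ∀ j, (1 + ρ) / 2 ≤ m j → ⟪e₂, b j⟫ ^ 2 ≤ 4 * δ ^ 2 * (1 / (1 - ρ) ^ 2) :=
      fun j hj => hcomp _ (m j - ρ) (pow_le_pow_left₀ (by linarith) (by linarith) 2) (hpart₂ j)
    have ha := hbig i₀ (hcon.trans h₀₁)
    have hb := hbig i₁ hcon
    have ha' := hperp i₀ (hlow.trans h₀₁)
    have hb' := hperp i₁ hlow
    have hmul := mul_sub_sq_le he₁ he₂ he (hbn i₀) (hbn i₁) (b.orthonormal.2 hne)
    have hl0 := hle i₀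
    have hl1 := hle i₁
    generalize ⟪e₁, b i₀⟫ = a0 at *
    generalize ⟪e₁, b i₁⟫ = a1 at *
    generalize ⟪e₂, b i₀⟫ = c0 at *
    generalize ⟪e₂, b i₁⟫ = c1 at *
    have hp : 1 / 2 < a0 ^ 2 := by linarith
    have hq : 1 / 2 < a1 ^ 2 := by linarith
    -- `|a0 a1| ≤ |c0 c1| + √(perp0 perp1)`, and the right side is at most `τ`
    generalize 4 * δ ^ 2 * (1 / ρ ^ 2) = A at *
    generalize 4 * δ ^ 2 * (1 / (1 - ρ) ^ 2) = B at *
    have h1 : |a0 * a1 + c0 * c1| ≤ A := by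
      apply abs_le_of_sq_le_sq _ (by linarith)
      refine hmul.trans ?_
      rw [sq A]
      exact mul_le_mul ha' hb' (by linarith) (by linarith)
    have h2 : |c0 * c1| ≤ B := by
      apply abs_le_of_sq_le_sq _ ((sq_nonneg _).trans ha)
      rw [mul_pow, sq B]
      exact mul_le_mul ha hb (sq_nonneg _) ((sq_nonneg _).trans ha)
    have h3 : |a0 * a1| < 1 / 2 := by
      rw [abs_lt]; rw [abs_le] at h1 h2; constructor <;> linarith
    have h4 : (a0 * a1) ^ 2 < (1 / 2) ^ 2 := sq_lt_sq' (abs_lt.1 h3).1 (abs_lt.1 h3).2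
    nlinarith
  have h1 : ⟪e₁, b i₁⟫ ^ 2 ≤ 4 * δ ^ 2 * (1 / (1 - ρ) ^ 2) :=
    hcomp _ (1 - m i₁) (pow_le_pow_left₀ (by linarith) (by linarith) 2)
      (by linarith [hpart₁ i₁])
  have h2 : 1 - τ ≤ ⟪e₂, b i₁⟫ ^ 2 := by linarith [hperp i₁ hlow]
  have hexp : ∀ s : ℝ, s ^ 2 = 1 → ‖b i₁ - s • e₂‖ ^ 2 = 2 - 2 * (s * ⟪e₂, b i₁⟫) := by
    intro s hs
    rw [norm_sub_sq_real, hbn, norm_smul, he₂, inner_smul_right, mul_one, Real.norm_eq_abs,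
      sq_abs, hs, real_inner_comm]
    ring
  have hc : ⟪e₂, b i₁⟫ ^ 2 ≤ 1 := by nlinarith [hle i₁, sq_nonneg ⟪e₁, b i₁⟫]
  have hτ8 : 8 * δ ^ 2 * (1 / ρ ^ 2 + 1 / (1 - ρ) ^ 2) = 2 * τ := by rw [hτ_def]; ring
  rw [hτ8]
  have habs := abs_le_of_sq_le_sq (b := (1 : ℝ)) (by simpa using hc) zero_le_one
  rw [abs_le] at habs
  -- The sign makes the inner product `|t|`, and `2 - 2|t| ≤ 2 - 2t² ≤ 2τ` because `|t| ≤ 1`.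
  rcases le_total 0 ⟪e₂, b i₁⟫ with h | h
  · exact ⟨1, by norm_num, by rw [hexp 1 (by norm_num)]; nlinarith⟩
  · exact ⟨-1, by norm_num, by rw [hexp (-1) (by norm_num)]; nlinarith⟩

end Perturbation
end SBM
-- Counting nodes whose crop has the wrong majority
namespace SBM

open MeasureTheory ProbabilityTheory Matrix

/-- Pigeonhole over the cells of equal label and equal `⌊4y⌋`, of which `8K + 1` per label meet
`[-K, K]`. Points of one cell are within `1/4` of each other, so a cell with one sparsely surrounded
point has at most `m` points of `W`. -/
lemma card_few_neighbours_le {V ι : Type*} [Fintype ι] [DecidableEq ι] (ℓ : V → ι) (y : V → ℝ)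
    (W : Finset V) (m K : ℕ) :
    (W.filter fun v => |y v| ≤ K ∧
      (W.filter fun w => ℓ w = ℓ v ∧ |y w - y v| ≤ 1 / 4).card ≤ m).card ≤
        m * (Fintype.card ι * (8 * K + 1)) := by
  classical
  have ht : ((Finset.univ : Finset ι) ×ˢ Finset.Icc (-(4 * K : ℤ)) (4 * K)).card =
      Fintype.card ι * (8 * K + 1) := by
    rw [Finset.card_product, Int.card_Icc, Finset.card_univ]
    congr 1
    omega
  rw [← ht]
  refine Finset.card_le_mul_card_image_of_maps_to
    (f := fun v => (ℓ v, ⌊4 * y v⌋)) (fun v hv => ?_) _ fun b _ => ?_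
  · obtain ⟨-, hv, -⟩ := Finset.mem_filter.1 hv
    rw [abs_le] at hv
    simp only [true_and, Finset.mem_product, Finset.mem_univ, Finset.mem_Icc]
    constructor
    · rw [Int.le_floor]; push_cast; linarith
    · have : ((⌊4 * y v⌋ : ℤ) : ℝ) ≤ ((4 * K : ℤ) : ℝ) :=
        (Int.floor_le _).trans (by push_cast; linarith)
      exact_mod_cast this
  · rcases Finset.eq_empty_or_nonempty
      ((W.filter fun v => |y v| ≤ K ∧
        (W.filter fun w => ℓ w = ℓ v ∧ |y w - y v| ≤ 1 / 4).card ≤ m).filter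
          fun v => (ℓ v, ⌊4 * y v⌋) = b) with h | ⟨v, hv⟩
    · rw [h]; simp
    · simp only [Finset.mem_filter] at hv
      refine le_trans (Finset.card_le_card fun w hw => ?_) hv.1.2.2
      simp only [Finset.mem_filter] at hw ⊢
      have heq := hw.2.trans hv.2.symm
      rw [Prod.mk.injEq] at heq
      refine ⟨hw.1.1, heq.1, ?_⟩
      have := Int.abs_sub_lt_one_of_floor_eq_floor heq.2
      rw [abs_lt] at this
      rw [abs_le]
      constructor <;> linarith

lemma card_lt_abs_mul_sq_le {V : Type*} [Fintype V] (y : V → ℝ) {K : ℝ} (hK : 0 ≤ K) :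
    ((Finset.univ.filter fun v => K < |y v|).card : ℝ) * K ^ 2 ≤ ∑ v, y v ^ 2 := by
  calc ((Finset.univ.filter fun v => K < |y v|).card : ℝ) * K ^ 2
      = ∑ v ∈ Finset.univ.filter fun v => K < |y v|, K ^ 2 := by
        rw [Finset.sum_const, nsmul_eq_mul]
    _ ≤ ∑ v ∈ Finset.univ.filter fun v => K < |y v|, y v ^ 2 := by
        refine Finset.sum_le_sum fun v hv => ?_
        rw [← sq_abs (y v)]
        exact pow_le_pow_left₀ hK (Finset.mem_filter.1 hv).2.le 2
    _ ≤ ∑ v, y v ^ 2 :=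
        Finset.sum_le_sum_of_subset_of_nonneg (Finset.filter_subset _ _)
          fun v _ _ => sq_nonneg _

variable {N : ℕ}

lemma majority_eq_some {S : Finset (Node N)} {a : Fin 2}
    (h : (S.filter fun w => label w ≠ a).card < (S.filter fun w => label w = a).card) :
    majority S = some a := by
  have key : ∀ a b : Fin 2, a ≠ b → (S.filter fun w => label w ≠ a) =
      S.filter fun w => label w = b := by
    intro a b hab
    refine Finset.filter_congr fun w _ => ?_
    generalize label w = c
    revert a b c
    decide
  match a with
  | 0 => rw [key 0 1 (by decide)] at h; simp [majority, h]
  | 1 => rw [key 1 0 (by decide)] at h; simp [majority, h, h.le]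

lemma mem_crop_iff {G : Graph N} (S : Eigensystem G) (hN : 2 ≤ N) (c : ℝ) (v w : Node N)
    (hc : 0 ≤ c) :
    w ∈ crop S hN (c / √(N : ℝ)) v ↔
      (√N * S.vector ⟨1, by lia⟩ w - √N * S.vector ⟨1, by lia⟩ v) ^ 2 +
        (√N * S.vector ⟨2, by lia⟩ w - √N * S.vector ⟨2, by lia⟩ v) ^ 2 ≤ c ^ 2 := by
  have hpos : 0 < √(N : ℝ) := Real.sqrt_pos.2 (by exact_mod_cast (by omega : 0 < N))
  simp only [crop, Finset.mem_filter, Finset.mem_univ, true_and]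
  rw [le_div_iff₀ hpos, ← sq_le_sq₀ (by positivity) hc, mul_pow, EuclideanSpace.real_norm_sq_eq,
    Fin.sum_univ_two]
  simp only [Eigensystem.coords, PiLp.sub_apply, Matrix.cons_val_zero,
    Matrix.cons_val_one]
  ring_nf

/-- If the second eigenvector separates the classes on the node set `W`, then all nodes but few
have a spectral crop with the right majority. -/
theorem card_majority_crop_ne_le {G : Graph N} (S : Eigensystem G) (hN : 2 ≤ N) (g : Fin 2 → ℝ)
    (hg : 1 ≤ |g 0 - g 1|) (W : Finset (Node N))
    (hW : ∀ w ∈ W, |√N * S.vector ⟨1, by lia⟩ w - g (label w)| ≤ 1 / 8) {K : ℕ} (hK : 0 < K) :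
    ((Finset.univ.filter fun v =>
        majority (crop S hN ((1 / 2 : ℝ) / √(N : ℝ)) v) ≠ some (label v)).card : ℝ) ≤
      (Wᶜ.card : ℝ) * (16 * K + 3) + N / K ^ 2 := by
  classical
  set y : Node N → ℝ := fun w => √N * S.vector ⟨2, by lia⟩ w with hy
  have hsum : ∑ v, y v ^ 2 = N := by
    have h := S.vector.orthonormal.1 ⟨2, by lia⟩
    have h2 := EuclideanSpace.real_norm_sq_eq (S.vector ⟨2, by lia⟩)
    rw [h] at h2
    simp only [hy, mul_pow, Real.sq_sqrt (Nat.cast_nonneg N)]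
    rw [← Finset.mul_sum, ← h2]
    simp
  set m := Wᶜ.card with hm
  set B₁ := Finset.univ.filter fun v => (K : ℝ) < |y v| with hB₁
  set B₂ := W.filter fun v => |y v| ≤ K ∧
      (W.filter fun w => label w = label v ∧ |y w - y v| ≤ 1 / 4).card ≤ m with hB₂
  -- A node fails only if it is badly placed in `λ₂`, has a large `λ₃`, or is sparsely surrounded in
  -- `λ₃`.
  have hsub : (Finset.univ.filter fun v =>
      majority (crop S hN ((1 / 2 : ℝ) / √(N : ℝ)) v) ≠ some (label v)) ⊆ Wᶜ ∪ (B₁ ∪ B₂) := by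
    intro v hv
    by_contra hcon
    simp only [Finset.mem_union, not_or, Finset.mem_compl, not_not, hB₁, hB₂, Finset.mem_filter,
      Finset.mem_univ, true_and, not_lt, not_and, not_le] at hcon
    obtain ⟨hvW, hvK, hfar⟩ := hcon
    refine (Finset.mem_filter.1 hv).2 (majority_eq_some (lt_of_le_of_lt ?_
      ((hfar hvW hvK).trans_le ?_)))
    -- Wrong labels in the crop come from outside `W`: two nodes of `W` in different classes differ
    -- in `√N λ₂` by at least `1 - 2/8`, more than the crop radius `1/2`.
    · refine Finset.card_le_card fun w hw => ?_
      rw [Finset.mem_filter, mem_crop_iff _ _ _ _ _ (by norm_num)] at hw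
      rw [Finset.mem_compl]
      intro hwW
      have h1 := abs_le.1 (hW w hwW)
      have h2 := abs_le.1 (hW v hvW)
      have h3 : 1 ≤ |g (label w) - g (label v)| := by
        have h4 := hw.2
        revert h4
        generalize label w = a
        generalize label v = b
        intro h4
        fin_cases a <;> fin_cases b <;> simp at h4 ⊢
        · exact hg
        · rwa [abs_sub_comm]
      have h5 : |√N * S.vector ⟨1, by lia⟩ w - √N * S.vector ⟨1, by lia⟩ v| ≤ 1 / 2 :=
        abs_le_of_sq_le_sq (by linarith [hw.1, sq_nonneg (√N * S.vector ⟨2, by lia⟩ w -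
          √N * S.vector ⟨2, by lia⟩ v)]) (by norm_num)
      rw [abs_le] at h5
      rw [le_abs] at h3
      rcases h3 with h3 | h3 <;> linarith
    -- Both coordinates differ by at most `1/4`, and `2 (1/4)² ≤ (1/2)²`.
    · refine Finset.card_le_card fun w hw => ?_
      simp only [Finset.mem_filter] at hw ⊢
      rw [mem_crop_iff _ _ _ _ _ (by norm_num)]
      obtain ⟨hwW, hl, hyw⟩ := hw
      refine ⟨?_, hl⟩
      have h1 := abs_le.1 (hW w hwW)
      have h2 := abs_le.1 (hW v hvW)
      rw [hl] at h1
      have h3 : |√N * S.vector ⟨1, by lia⟩ w - √N * S.vector ⟨1, by lia⟩ v| ≤ 1 / 4 := by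
        rw [abs_le]; constructor <;> linarith
      have h4 := sq_le_sq' (abs_le.1 h3).1 (abs_le.1 h3).2
      have h5 := sq_le_sq' (abs_le.1 hyw).1 (abs_le.1 hyw).2
      simp only [hy] at h5
      linarith
  have hB₁c : (B₁.card : ℝ) ≤ N / K ^ 2 := by
    rw [le_div_iff₀ (by positivity), ← hsum]
    exact card_lt_abs_mul_sq_le y (Nat.cast_nonneg K)
  have hB₂c : (B₂.card : ℝ) ≤ m * (2 * (8 * K + 1)) := by
    have h := card_few_neighbours_le (label (N := N)) y W m K
    rw [Fintype.card_fin] at h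
    exact_mod_cast h
  have hc : ((Finset.univ.filter fun v =>
      majority (crop S hN ((1 / 2 : ℝ) / √(N : ℝ)) v) ≠ some (label v)).card : ℝ) ≤
        m + (B₁.card + B₂.card) := by
    exact_mod_cast (Finset.card_le_card hsub).trans ((Finset.card_union_le _ _).trans
      (Nat.add_le_add_left (Finset.card_union_le _ _) _))
  linarith

/-- Chebyshev's inequality for the distance of a vector from its class averages. -/
lemma card_far_le (x : EuclideanSpace ℝ (Node N)) (e : Node N → ℝ) :
    ((Finset.univ.filter fun w => (1 / 8 : ℝ) < |√N * x w - √N * e w|).card : ℝ) ≤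
      64 * N * ∑ w, (x w - e w) ^ 2 := by
  have h := card_lt_abs_mul_sq_le (fun w => √N * x w - √N * e w) (K := 1 / 8) (by norm_num)
  have h2 : ∑ w, (√N * x w - √N * e w) ^ 2 = N * ∑ w, (x w - e w) ^ 2 := by
    rw [Finset.mul_sum]
    refine Finset.sum_congr rfl fun w _ => ?_
    rw [← mul_sub, mul_pow, Real.sq_sqrt (Nat.cast_nonneg N)]
  rw [h2] at h
  linarith

end SBM
-- Concentration of the noise
namespace SBM

open MeasureTheory ProbabilityTheory Matrix

variable {N : ℕ} {p q z : unitInterval}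

instance : IsProbabilityMeasure (law N p q z) := by unfold law; infer_instance

/-- The centred edge indicator of an unordered pair of nodes. -/
noncomputable def noise (p q z : unitInterval) (G : Graph N) (e : Sym2 (Node N)) : ℝ :=
  (if G e then 1 else 0) - (edgeProb p q z e : ℝ)

lemma abs_noise_le (G : Graph N) (e : Sym2 (Node N)) : |noise p q z G e| ≤ 1 := by
  have h0 := (edgeProb p q z e).2.1
  have h1 := (edgeProb p q z e).2.2
  rw [noise, abs_le]
  split_ifs <;> constructor <;> linarith

lemma integral_centred_bernoulli (r : unitInterval) :
    ∫ b, ((if b then (1 : ℝ) else 0) - r) ∂(bernoulliMeasure true false r) = 0 := by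
  rw [integral_bernoulliMeasure]
  simp
  ring

lemma integral_prod_noise {s : Finset (Sym2 (Node N))} (hs : s.Nonempty) :
    ∫ G, ∏ e ∈ s, noise p q z G e ∂law N p q z = 0 := by
  classical
  have h := integral_fintype_prod_eq_prod (𝕜 := ℝ)
    (μ := fun e : Sym2 (Node N) => bernoulliMeasure true false (edgeProb p q z e))
    (fun e b => if e ∈ s then (if b then (1 : ℝ) else 0) - edgeProb p q z e else 1)
  obtain ⟨e, he⟩ := hs
  rw [Finset.prod_eq_zero (Finset.mem_univ e)
    (by simp only [he, if_true]; exact integral_centred_bernoulli _)] at h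
  rw [← h]
  simp only [Fintype.prod_ite_mem]
  rfl

lemma integral_noise (e : Sym2 (Node N)) : ∫ G, noise p q z G e ∂law N p q z = 0 := by
  simpa using integral_prod_noise (p := p) (q := q) (z := z) (Finset.singleton_nonempty e)

/-- The conditions make the four unordered pairs distinct, even when `w' = u`, so independence
applies. -/
lemma integral_noise_four_eq_zero {u v w w' : Node N} (huv : u ≠ v) (hww : w ≠ w') (hwu : w ≠ u)
    (hwv : w ≠ v) (hwv' : w' ≠ v) :
    ∫ G, noise p q z G s(u, w) * noise p q z G s(w, v) *
      (noise p q z G s(u, w') * noise p q z G s(w', v)) ∂law N p q z = 0 := by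
  classical
  rw [← integral_prod_noise (p := p) (q := q) (z := z)
    (s := {s(u, w), s(w, v), s(u, w'), s(w', v)}) (by simp)]
  congr 1
  ext G
  rw [Finset.prod_insert, Finset.prod_insert, Finset.prod_insert, Finset.prod_singleton]
  · ring
  all_goals
    simp only [Finset.mem_insert, Finset.mem_singleton, Sym2.eq_iff, not_or, not_and]
    grind

lemma integral_noise_four_le (u v w w' : Node N) :
    ∫ G, noise p q z G s(u, w) * noise p q z G s(w, v) *
      (noise p q z G s(u, w') * noise p q z G s(w', v)) ∂law N p q z ≤
      (if u = v then 1 else 0) + (if w = w' then 1 else 0) + (if w = u then 1 else 0) +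
        (if w = v then 1 else 0) + (if w' = v then 1 else 0) := by
  by_cases h : u ≠ v ∧ w ≠ w' ∧ w ≠ u ∧ w ≠ v ∧ w' ≠ v
  · obtain ⟨h1, h2, h3, h4, h6⟩ := h
    rw [integral_noise_four_eq_zero h1 h2 h3 h4 h6]
    positivity
  · have hle : ∫ G, noise p q z G s(u, w) * noise p q z G s(w, v) *
        (noise p q z G s(u, w') * noise p q z G s(w', v)) ∂law N p q z ≤
          ∫ _, (1 : ℝ) ∂law N p q z := by
      refine integral_mono Integrable.of_finite Integrable.of_finite fun G => ?_
      refine (le_abs_self _).trans ?_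
      simp only [abs_mul]
      have h := fun e => abs_noise_le (p := p) (q := q) (z := z) G e
      exact mul_le_one₀ (mul_le_one₀ (h _) (abs_nonneg _) (h _)) (by positivity)
        (mul_le_one₀ (h _) (abs_nonneg _) (h _))
    rw [integral_const, probReal_univ, one_smul] at hle
    refine hle.trans ?_
    have hnn : ∀ P : Prop, [Decidable P] → (0 : ℝ) ≤ if P then 1 else 0 := by
      intro P _; split_ifs <;> norm_num
    have h1 := hnn (u = v)
    have h2 := hnn (w = w')
    have h3 := hnn (w = u)
    have h4 := hnn (w = v)
    have h6 := hnn (w' = v)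
    by_contra hcon
    refine h ⟨?_, ?_, ?_, ?_, ?_⟩ <;> (rintro rfl; simp only [if_true] at hcon; linarith)

/-- The centred adjacency matrix. -/
noncomputable def noiseMatrix (p q z : unitInterval) (G : Graph N) :
    Matrix (Node N) (Node N) ℝ :=
  Matrix.of fun u w => noise p q z G s(u, w)

/-- Only index quadruples with one of five coincidences contribute, and each coincidence leaves
three free indices. -/
lemma integral_sum_sq_noiseMatrix_sq_le :
    ∫ G, ∑ u, ∑ v, ((noiseMatrix p q z G * noiseMatrix p q z G) u v) ^ 2 ∂law N p q z ≤
      5 * (2 * N : ℝ) ^ 3 := by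
  have hexp : ∀ G : Graph N, ∑ u, ∑ v,
      ((noiseMatrix p q z G * noiseMatrix p q z G) u v) ^ 2 =
      ∑ u, ∑ v, ∑ w, ∑ w', noise p q z G s(u, w) * noise p q z G s(w, v) *
        (noise p q z G s(u, w') * noise p q z G s(w', v)) := by
    intro G
    refine Finset.sum_congr rfl fun u _ => Finset.sum_congr rfl fun v _ => ?_
    rw [Matrix.mul_apply, sq, Finset.sum_mul_sum]
    rfl
  simp only [hexp]
  have hint : ∀ f : Graph N → ℝ, Integrable f (law N p q z) := fun f => Integrable.of_finite
  simp only [integral_finsetSum _ fun _ _ => hint _]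
  have hcard : (Fintype.card (Node N) : ℝ) = 2 * N := by simp
  calc _ ≤ ∑ u : Node N, ∑ v : Node N, ∑ w : Node N, ∑ w' : Node N,
      (((if u = v then 1 else 0) + (if w = w' then 1 else 0) + (if w = u then 1 else 0) +
        (if w = v then 1 else 0) + (if w' = v then 1 else 0)) : ℝ) :=
        Finset.sum_le_sum fun u _ => Finset.sum_le_sum fun v _ => Finset.sum_le_sum fun w _ =>
          Finset.sum_le_sum fun w' _ => integral_noise_four_le u v w w'
    _ = 5 * (2 * N : ℝ) ^ 3 := by
        simp only [Finset.sum_add_distrib, Finset.sum_ite_eq, Finset.sum_ite_eq', Finset.mem_univ,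
          if_true, Finset.sum_const, Finset.card_univ, nsmul_eq_mul, hcard, mul_ite, mul_one,
          mul_zero]
        ring

open scoped Matrix.Norms.L2Operator in
lemma norm_sq_le_sum_sq {V : Type*} [Fintype V] [DecidableEq V] (A : Matrix V V ℝ) :
    ‖A‖ ^ 2 ≤ ∑ u, ∑ v, A u v ^ 2 := by
  have hnn : 0 ≤ ∑ u, ∑ v, A u v ^ 2 := by positivity
  refine (sq_le_sq₀ (norm_nonneg _) (Real.sqrt_nonneg _)).2 ?_ |>.trans_eq (Real.sq_sqrt hnn)
  rw [← l2_opNorm_toEuclideanCLM]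
  refine ContinuousLinearMap.opNorm_le_bound _ (Real.sqrt_nonneg _) fun x => ?_
  refine (sq_le_sq₀ (norm_nonneg _) (by positivity)).1 ?_
  rw [mul_pow, Real.sq_sqrt hnn, EuclideanSpace.real_norm_sq_eq, EuclideanSpace.real_norm_sq_eq,
    Finset.sum_mul]
  refine Finset.sum_le_sum fun u _ => ?_
  rw [ofLp_toEuclideanCLM]
  exact Finset.sum_mul_sq_le_sq_mul_sq _ _ _

lemma noiseMatrix_conjTranspose (G : Graph N) :
    (noiseMatrix p q z G)ᴴ = noiseMatrix p q z G := by
  ext u v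
  simp [noiseMatrix, Matrix.conjTranspose_apply, Sym2.eq_swap]

open scoped Matrix.Norms.L2Operator in
-- By symmetry `‖X‖² = ‖X²‖`. The Frobenius norm is applied to `X²` because that of `X` itself can
-- be of order `N`, too large for a bound `δN`.
lemma norm_noiseMatrix_pow_four_le (G : Graph N) :
    ‖noiseMatrix p q z G‖ ^ 4 ≤
      ∑ u, ∑ v, ((noiseMatrix p q z G * noiseMatrix p q z G) u v) ^ 2 := by
  refine le_trans (le_of_eq ?_) (norm_sq_le_sum_sq _)
  have h := l2_opNorm_conjTranspose_mul_self (noiseMatrix p q z G)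
  rw [noiseMatrix_conjTranspose] at h
  rw [h]; ring

open scoped Matrix.Norms.L2Operator in
lemma measure_norm_noiseMatrix_gt_le {δ : ℝ} (hδ : 0 < δ) (hN : 0 < N) :
    (law N p q z).real {G | δ * N < ‖noiseMatrix p q z G‖} ≤ 40 / (δ ^ 4 * N) := by
  have hN' : (0 : ℝ) < N := by exact_mod_cast hN
  have h := mul_meas_ge_le_integral_of_nonneg (μ := law N p q z)
    (f := fun G => ∑ u, ∑ v, ((noiseMatrix p q z G * noiseMatrix p q z G) u v) ^ 2)
    (Filter.Eventually.of_forall fun G => by positivity) Integrable.of_finite ((δ * N) ^ 4)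
  have h2 := h.trans integral_sum_sq_noiseMatrix_sq_le
  have h3 : (law N p q z).real {G | δ * N < ‖noiseMatrix p q z G‖} ≤
      (law N p q z).real {G | (δ * N) ^ 4 ≤
        ∑ u, ∑ v, ((noiseMatrix p q z G * noiseMatrix p q z G) u v) ^ 2} := by
    refine measureReal_mono fun G hG => ?_
    exact (pow_le_pow_left₀ (by positivity) (le_of_lt hG) 4).trans
      (norm_noiseMatrix_pow_four_le G)
  refine h3.trans ?_
  rw [le_div_iff₀ (by positivity)]
  have h4 : (0 : ℝ) < N ^ 3 := by positivity
  refine le_of_mul_le_mul_right ?_ h4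
  linarith

lemma iIndepFun_noise : iIndepFun (fun e G => noise p q z G e) (law N p q z) :=
  iIndepFun_pi (X := fun (e : Sym2 (Node N)) (b : Bool) =>
    (if b then (1 : ℝ) else 0) - edgeProb p q z e) fun _ => Measurable.of_discrete.aemeasurable

lemma edge_injective (u : Node N) (c : Fin 2) :
    Function.Injective fun i : Fin N => s(u, ((c, i) : Node N)) := by
  intro i j h
  have := Sym2.congr_right.1 h
  exact (Prod.mk.inj this).2

/-- Hoeffding's inequality on both tails; each term lies in an interval of length `1`, hence has
variance proxy `1/4`. -/
lemma measure_sum_noise_ge_le (u : Node N) (c : Fin 2) {δ : ℝ} (hδ : 0 < δ) :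
    (law N p q z).real {G | δ * N < |∑ i : Fin N, noise p q z G s(u, (c, i))|} ≤
      2 * Real.exp (-(2 * δ ^ 2) * N) := by
  have hind := (iIndepFun_noise (p := p) (q := q) (z := z)).precomp (edge_injective u c)
  have hsub : ∀ e : Sym2 (Node N),
      HasSubgaussianMGF (fun G => noise p q z G e) ((‖(1 : ℝ)‖₊ / 2) ^ 2) (law N p q z) := by
    intro e
    have h := hasSubgaussianMGF_of_mem_Icc_of_integral_eq_zero (μ := law N p q z)
      (X := fun G => noise p q z G e) (a := -(edgeProb p q z e : ℝ))
      (b := 1 - (edgeProb p q z e : ℝ)) Measurable.of_discrete.aemeasurable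
      (Filter.Eventually.of_forall fun G => by
        simp only [noise, Set.mem_Icc]; split_ifs <;> constructor <;> linarith)
      (integral_noise e)
    simpa using h
  have hexp : Real.exp (-(δ * N) ^ 2 / (2 * ∑ i : Fin N, (((‖(1 : ℝ)‖₊ / 2) ^ 2 : NNReal) : ℝ))) =
      Real.exp (-(2 * δ ^ 2) * N) := by
    congr 1
    rcases Nat.eq_zero_or_pos N with h | h
    · simp [h]
    · have hN' : (N : ℝ) ≠ 0 := by positivity
      simp
      field_simp
  have h1 := HasSubgaussianMGF.measure_sum_ge_le_of_iIndepFun hind (s := Finset.univ)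
    (c := fun _ => (‖(1 : ℝ)‖₊ / 2) ^ 2) (fun i _ => hsub _) (ε := δ * N) (by positivity)
  have h2 := HasSubgaussianMGF.measure_sum_ge_le_of_iIndepFun
    (X := fun i G => - noise p q z G s(u, (c, i)))
    (hind.comp (fun _ x => -x) fun _ => measurable_neg) (s := Finset.univ)
    (c := fun _ => (‖(1 : ℝ)‖₊ / 2) ^ 2) (fun i _ => (hsub _).neg) (ε := δ * N) (by positivity)
  simp only [NNReal.coe_sum] at h1 h2
  push_cast at h1 h2 hexp
  rw [hexp] at h1 h2
  have hun : {G | δ * N < |∑ i : Fin N, noise p q z G s(u, (c, i))|} ⊆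
      {G | δ * N ≤ ∑ i : Fin N, noise p q z G s(u, (c, i))} ∪
        {G | δ * N ≤ ∑ i : Fin N, -noise p q z G s(u, (c, i))} := by
    intro G hG
    rcases lt_abs.1 (Set.mem_ofPred.1 hG) with h | h
    · exact Or.inl h.le
    · right; simpa using h.le
  calc _ ≤ _ := measureReal_mono hun
    _ ≤ _ := measureReal_union_le _ _
    _ ≤ _ := by rw [two_mul]; exact add_le_add h1 h2

end SBM
-- Typical graphs and their ego networks
namespace SBM

open MeasureTheory ProbabilityTheory Matrix

variable {N : ℕ} {p q z : unitInterval}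

/-- The edge probability inside a class. -/
def rate (p q : unitInterval) (c : Fin 2) : ℝ := if c = 0 then p else q

/-- The expected degree of a node, divided by `N`. -/
def meanDegree (p q z : unitInterval) (c : Fin 2) : ℝ := rate p q c + z

lemma edgeProb_mk (u w : Node N) :
    (edgeProb p q z s(u, w) : ℝ) = if label u = label w then rate p q (label u) else z := by
  simp only [edgeProb, Sym2.lift_mk, rate]
  split_ifs <;> rfl

/-- The event that the adjacency matrix and all its class degrees are close to their means. -/
def IsTypical (p q z : unitInterval) (δ : ℝ) (G : Graph N) : Prop :=
  (open scoped Matrix.Norms.L2Operator in ‖noiseMatrix p q z G‖ ≤ δ * N) ∧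
    ∀ u c, |∑ i : Fin N, noise p q z G s(u, (c, i))| ≤ δ * N

lemma sum_adj_class (G : Graph N) (u : Node N) (c : Fin 2) :
    ∑ i : Fin N, adj G u (c, i) =
      N * (if label u = c then rate p q (label u) else z) +
        ∑ i : Fin N, noise p q z G s(u, (c, i)) := by
  have h : ∀ i : Fin N, adj G u (c, i) =
      (if label u = c then rate p q (label u) else z) + noise p q z G s(u, (c, i)) := by
    intro i
    rw [noise, edgeProb_mk]
    exact (add_sub_cancel _ _).symm
  simp only [h, Finset.sum_add_distrib, Finset.sum_const, Finset.card_univ, Fintype.card_fin,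
    nsmul_eq_mul]

lemma degree_eq (G : Graph N) (u : Node N) :
    degree G u = N * meanDegree p q z (label u) +
      (∑ i : Fin N, noise p q z G s(u, (0, i)) + ∑ i : Fin N, noise p q z G s(u, (1, i))) := by
  have h : degree G u = ∑ i : Fin N, adj G u (0, i) + ∑ i : Fin N, adj G u (1, i) := by
    rw [degree, Fintype.sum_prod_type, Fin.sum_univ_two]
  rw [h, sum_adj_class (p := p) (q := q) (z := z), sum_adj_class (p := p) (q := q) (z := z),
    meanDegree]
  generalize label u = c
  fin_cases c <;> simp <;> ring

lemma IsTypical.abs_degree_sub_le {δ : ℝ} {G : Graph N} (h : IsTypical p q z δ G) (u : Node N) :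
    |degree G u - N * meanDegree p q z (label u)| ≤ 2 * δ * N := by
  rw [degree_eq (p := p) (q := q) (z := z), add_sub_cancel_left]
  refine (abs_add_le _ _).trans ?_
  linarith [h.2 u 0, h.2 u 1]

lemma majority_ego_zero (G : Graph N) (v : Node N) : majority (ego G 0 v) = some (label v) := by
  have : ego G 0 v = {v} := by
    ext w
    simp [ego, @eq_comm _ w v]
  rw [this]
  refine majority_eq_some ?_
  simp [Finset.filter_singleton]

lemma mem_ego_one_iff (G : Graph N) (v w : Node N) :
    w ∈ ego G 1 v ↔ v = w ∨ (v ≠ w ∧ G s(v, w) = true) := by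
  simp [ego, SimpleGraph.edist_le_one_iff_adj_or_eq, simple, or_comm]

lemma card_filter_edge (G : Graph N) (v : Node N) (c : Fin 2) :
    ((Finset.univ.filter fun i : Fin N => G s(v, (c, i)) = true).card : ℝ) =
      ∑ i : Fin N, adj G v (c, i) := by
  simp [adj]

lemma IsTypical.majority_ego_one {δ : ℝ} {G : Graph N} (h : IsTypical p q z δ G) (hN : 0 < N)
    (hqp : q ≤ p) (hδ : 2 * δ < q - z) (v : Node N) :
    majority (ego G 1 v) = some (label v) := by
  classical
  have hN' : (0 : ℝ) < N := by exact_mod_cast hN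
  obtain ⟨b, hb, hb'⟩ : ∃ b : Fin 2, label v ≠ b ∧ ∀ c, c ≠ label v → c = b := by
    generalize label v = a
    revert a; decide
  refine majority_eq_some ?_
  have hinj : ∀ c : Fin 2, Function.Injective fun i : Fin N => ((c, i) : Node N) :=
    fun c i j hij => (Prod.mk.inj hij).2
  -- `v` carries its own label, so every wrongly labelled member is a genuine neighbour. A self-edge
  -- of `v` is harmless in `h2`, as `v` is in its ego network anyway.
  have h1 : ((ego G 1 v).filter fun w => label w ≠ label v).card ≤
      (Finset.univ.filter fun i : Fin N => G s(v, (b, i)) = true).card := by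
    rw [← Finset.card_image_of_injective _ (hinj b)]
    refine Finset.card_le_card fun w hw => ?_
    rw [Finset.mem_filter, mem_ego_one_iff] at hw
    have hwb : w = (b, w.2) := Prod.ext (hb' _ hw.2) rfl
    rw [Finset.mem_image]
    refine ⟨w.2, ?_, hwb.symm⟩
    rw [Finset.mem_filter, ← hwb]
    rcases hw.1 with h | h
    · exact absurd (by rw [h]) hw.2
    · exact ⟨Finset.mem_univ _, h.2⟩
  have h2 : (Finset.univ.filter fun i : Fin N => G s(v, (label v, i)) = true).card ≤
      ((ego G 1 v).filter fun w => label w = label v).card := by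
    rw [← Finset.card_image_of_injective _ (hinj (label v))]
    refine Finset.card_le_card fun w hw => ?_
    obtain ⟨i, hi, rfl⟩ := Finset.mem_image.1 hw
    rw [Finset.mem_filter, mem_ego_one_iff]
    refine ⟨?_, rfl⟩
    by_cases hv : v = (label v, i)
    · exact Or.inl hv
    · exact Or.inr ⟨hv, (Finset.mem_filter.1 hi).2⟩
  refine h1.trans_lt (lt_of_lt_of_le ?_ h2)
  have h3 : ((Finset.univ.filter fun i : Fin N => G s(v, (b, i)) = true).card : ℝ) <
      (Finset.univ.filter fun i : Fin N => G s(v, (label v, i)) = true).card := by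
    rw [card_filter_edge, card_filter_edge, sum_adj_class (p := p) (q := q) (z := z),
      sum_adj_class (p := p) (q := q) (z := z), if_neg hb, if_pos rfl]
    have ha := abs_le.1 (h.2 v b)
    have ha' := abs_le.1 (h.2 v (label v))
    have hr : (q : ℝ) ≤ rate p q (label v) := by
      have : (q : ℝ) ≤ p := hqp
      rw [rate]; split_ifs <;> simp [this]
    nlinarith
  exact_mod_cast h3

end SBM
-- The mean normalized adjacency matrix
namespace SBM

open MeasureTheory ProbabilityTheory Matrix
open scoped Matrix.Norms.L2Operator RealInnerProductSpace

variable {N : ℕ} {p q z : unitInterval}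

lemma abs_inv_sqrt_sub_le {a x y : ℝ} (ha : 0 < a) (hx : a ≤ x) (hy : a ≤ y) :
    |(√x)⁻¹ - (√y)⁻¹| ≤ |x - y| / (2 * a * √a) := by
  have hsx : √a ≤ √x := Real.sqrt_le_sqrt hx
  have hsy : √a ≤ √y := Real.sqrt_le_sqrt hy
  have hsa : 0 < √a := Real.sqrt_pos.2 ha
  have hsx0 := hsa.trans_le hsx
  have hsy0 := hsa.trans_le hsy
  have h1 : (√x)⁻¹ - (√y)⁻¹ = (y - x) / (√x * √y * (√x + √y)) := by
    have hxx := Real.sq_sqrt (ha.le.trans hx)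
    have hyy := Real.sq_sqrt (ha.le.trans hy)
    have h : y - x = (√y - √x) * (√x + √y) := by rw [← hxx, ← hyy]; simp; ring
    rw [h]
    field_simp
  rw [h1, abs_div, abs_sub_comm, abs_of_pos (by positivity : 0 < √x * √y * (√x + √y))]
  refine div_le_div_of_nonneg_left (abs_nonneg _) (by positivity) ?_
  calc 2 * a * √a = √a * √a * (√a + √a) := by rw [Real.mul_self_sqrt ha.le]; ring
    _ ≤ √x * √y * (√x + √y) := by gcongr

/-- The mean of the adjacency matrix. -/
def meanAdj (N : ℕ) (p q z : unitInterval) : Matrix (Node N) (Node N) ℝ :=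
  Matrix.of fun u w => (edgeProb p q z s(u, w) : ℝ)

lemma adj_eq_add (G : Graph N) : adj G = noiseMatrix p q z G + meanAdj N p q z := by
  ext u w
  simp [adj, noiseMatrix, meanAdj, noise]

lemma norm_meanAdj_le : ‖meanAdj N p q z‖ ≤ 2 * N := by
  refine (sq_le_sq₀ (norm_nonneg _) (by positivity)).1 ((norm_sq_le_sum_sq _).trans ?_)
  calc ∑ u, ∑ v, meanAdj N p q z u v ^ 2 ≤ ∑ u : Node N, ∑ v : Node N, (1 : ℝ) := by
        refine Finset.sum_le_sum fun u _ => Finset.sum_le_sum fun v _ => ?_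
        exact pow_le_one₀ (edgeProb p q z s(u, v)).2.1 (edgeProb p q z s(u, v)).2.2
    _ = (2 * N) ^ 2 := by simp; ring

/-- The diagonal matrix of the inverse square roots of the mean degrees. -/
noncomputable def meanInvSqrt (N : ℕ) (p q z : unitInterval) : Matrix (Node N) (Node N) ℝ :=
  Matrix.diagonal fun u => (√(N * meanDegree p q z (label u)))⁻¹

lemma two_mul_le_meanDegree (hzq : z ≤ q) (hqp : q ≤ p) (c : Fin 2) :
    2 * (z : ℝ) ≤ meanDegree p q z c := by
  have h1 : (z : ℝ) ≤ q := hzq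
  have h2 : (q : ℝ) ≤ p := hqp
  rw [meanDegree, rate]
  split_ifs <;> linarith

/-- The normalized adjacency matrix of a typical graph is close to its deterministic analogue. -/
lemma IsTypical.norm_normalized_sub_le {δ : ℝ} {G : Graph N} (h : IsTypical p q z δ G)
    (hN : 0 < N) (hz : 0 < z) (hzq : z ≤ q) (hqp : q ≤ p) (hδ : 2 * δ ≤ z) (hδ₀ : 0 ≤ δ) :
    ‖invSqrtDegree G * adj G * invSqrtDegree G -
      meanInvSqrt N p q z * meanAdj N p q z * meanInvSqrt N p q z‖ ≤ 5 * δ / (z : ℝ) ^ 2 := by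
  have hN' : (0 : ℝ) < N := by exact_mod_cast hN
  have hz' : (0 : ℝ) < z := hz
  have hz1 : (z : ℝ) ≤ 1 := z.2.2
  -- A common lower bound: mean degrees are at least `2zN`, and actual degrees lose at most `2δN ≤
  -- zN`.
  set a : ℝ := z * N with ha_def
  have ha : 0 < a := by positivity
  have hd : ∀ u : Node N, a ≤ N * meanDegree p q z (label u) := fun u => by
    nlinarith [two_mul_le_meanDegree hzq hqp (label u)]
  have hD : ∀ u : Node N, a ≤ degree G u := fun u => by
    have h1 := (abs_le.1 (h.abs_degree_sub_le u)).1
    nlinarith [two_mul_le_meanDegree hzq hqp (label u)]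
  have hsa : 0 < √a := Real.sqrt_pos.2 ha
  have hle : ∀ x, a ≤ x → |(√x)⁻¹| ≤ (√a)⁻¹ := fun x hx => by
    rw [abs_of_nonneg (by positivity)]
    exact inv_anti₀ hsa (Real.sqrt_le_sqrt hx)
  have hs : ‖invSqrtDegree G‖ ≤ (√a)⁻¹ := by
    rw [invSqrtDegree, l2_opNorm_diagonal, pi_norm_le_iff_of_nonneg (by positivity)]
    exact fun u => hle _ (hD u)
  have ht : ‖meanInvSqrt N p q z‖ ≤ (√a)⁻¹ := by
    rw [meanInvSqrt, l2_opNorm_diagonal, pi_norm_le_iff_of_nonneg (by positivity)]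
    exact fun u => hle _ (hd u)
  have hst : ‖invSqrtDegree G - meanInvSqrt N p q z‖ ≤ δ / z * (√a)⁻¹ := by
    rw [invSqrtDegree, meanInvSqrt, Matrix.diagonal_sub, l2_opNorm_diagonal,
      pi_norm_le_iff_of_nonneg (by positivity)]
    intro u
    refine (abs_inv_sqrt_sub_le ha (hD u) (hd u)).trans ?_
    rw [div_le_iff₀ (by positivity)]
    refine (h.abs_degree_sub_le u).trans (le_of_eq ?_)
    rw [ha_def]
    field_simp
  -- Telescoping: first the adjacency matrix is replaced by its mean, then the two diagonal factors
  -- one at a time.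
  have hdecomp : invSqrtDegree G * adj G * invSqrtDegree G -
      meanInvSqrt N p q z * meanAdj N p q z * meanInvSqrt N p q z =
      invSqrtDegree G * noiseMatrix p q z G * invSqrtDegree G +
      ((invSqrtDegree G - meanInvSqrt N p q z) * meanAdj N p q z * invSqrtDegree G +
        meanInvSqrt N p q z * meanAdj N p q z * (invSqrtDegree G - meanInvSqrt N p q z)) := by
    rw [adj_eq_add (p := p) (q := q) (z := z)]
    noncomm_ring
  have hmul : ∀ (A B C : Matrix (Node N) (Node N) ℝ) (x y w : ℝ), ‖A‖ ≤ x → ‖B‖ ≤ y → ‖C‖ ≤ w →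
      ‖A * B * C‖ ≤ x * y * w := fun A B C x y w hA hB hC =>
    (norm_mul_le _ _).trans (mul_le_mul ((norm_mul_le _ _).trans
      (mul_le_mul hA hB (norm_nonneg _) ((norm_nonneg _).trans hA))) hC (norm_nonneg _)
        (mul_nonneg ((norm_nonneg _).trans hA) ((norm_nonneg _).trans hB)))
  have h1 := hmul _ _ _ _ _ _ hs h.1 hs
  have h2 := hmul _ _ _ _ _ _ hst (norm_meanAdj_le (N := N) (p := p) (q := q) (z := z)) hs
  have h3 := hmul _ _ _ _ _ _ ht (norm_meanAdj_le (N := N) (p := p) (q := q) (z := z)) hst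
  have hinv : (√a)⁻¹ * (√a)⁻¹ = 1 / (z * N) := by
    rw [← mul_inv, Real.mul_self_sqrt ha.le, one_div]
  rw [hdecomp]
  refine ((norm_add_le _ _).trans (add_le_add h1 ((norm_add_le _ _).trans
    (add_le_add h2 h3)))).trans ?_
  calc _ = ((√a)⁻¹ * (√a)⁻¹) * (δ * N + δ / z * (2 * N) + δ / z * (2 * N)) := by ring
    _ = δ * z / z ^ 2 + 4 * δ / z ^ 2 := by
        rw [hinv]; field_simp; ring
    _ ≤ 5 * δ / z ^ 2 := by
        rw [← add_div]
        refine div_le_div_of_nonneg_right ?_ (by positivity)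
        nlinarith

/-- The top eigenvector of the mean normalized adjacency matrix. -/
noncomputable def topVector (N : ℕ) (p q z : unitInterval) : EuclideanSpace ℝ (Node N) :=
  WithLp.toLp 2 fun u =>
    √(meanDegree p q z (label u)) / √(N * (meanDegree p q z 0 + meanDegree p q z 1))

/-- The value, up to a common factor, of the second eigenvector of the mean normalized adjacency
matrix on a class. -/
noncomputable def separator (p q z : unitInterval) (c : Fin 2) : ℝ :=
  (if c = 0 then √(meanDegree p q z 1) else -√(meanDegree p q z 0)) /
    √(meanDegree p q z 0 + meanDegree p q z 1)

/-- The second eigenvector of the mean normalized adjacency matrix. -/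
noncomputable def secondVector (N : ℕ) (p q z : unitInterval) : EuclideanSpace ℝ (Node N) :=
  WithLp.toLp 2 fun u => separator p q z (label u) / √N

/-- The second eigenvalue of the mean normalized adjacency matrix. -/
noncomputable def secondValue (p q z : unitInterval) : ℝ :=
  ((p : ℝ) * q - z ^ 2) / (meanDegree p q z 0 * meanDegree p q z 1)

lemma meanDegree_pos (hz : 0 < z) (c : Fin 2) : 0 < meanDegree p q z c := by
  have hz' : (0 : ℝ) < z := hz
  have := p.2.1
  have := q.2.1
  rw [meanDegree, rate]
  split_ifs <;> linarith

lemma secondValue_pos (hz : 0 < z) (hzq : z < q) (hqp : q < p) : 0 < secondValue p q z := by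
  have hz' : (0 : ℝ) < z := hz
  have h1 : (z : ℝ) < q := hzq
  have h2 : (q : ℝ) < p := hqp
  refine div_pos ?_ (mul_pos (meanDegree_pos hz 0) (meanDegree_pos hz 1))
  nlinarith

lemma secondValue_lt_one (hz : 0 < z) : secondValue p q z < 1 := by
  have hz' : (0 : ℝ) < z := hz
  have := p.2.1
  have := q.2.1
  rw [secondValue, div_lt_one (mul_pos (meanDegree_pos hz 0) (meanDegree_pos hz 1))]
  simp only [meanDegree, rate, if_true, one_ne_zero, if_false]
  nlinarith

lemma sum_node (f : Fin 2 → ℝ) : ∑ u : Node N, f (label u) = N * (f 0 + f 1) := by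
  rw [Fintype.sum_prod_type, Fin.sum_univ_two]
  simp [label]
  ring

lemma norm_topVector (hN : 0 < N) (hz : 0 < z) : ‖topVector N p q z‖ = 1 := by
  have hN' : (0 : ℝ) < N := by exact_mod_cast hN
  have h0 := meanDegree_pos (p := p) (q := q) hz 0
  have h1 := meanDegree_pos (p := p) (q := q) hz 1
  rw [← sq_eq_sq₀ (norm_nonneg _) zero_le_one, EuclideanSpace.real_norm_sq_eq]
  simp only [topVector, div_pow]
  rw [sum_node fun c => √(meanDegree p q z c) ^ 2 /
    √(N * (meanDegree p q z 0 + meanDegree p q z 1)) ^ 2, Real.sq_sqrt h0.le, Real.sq_sqrt h1.le,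
    Real.sq_sqrt (by positivity)]
  field_simp

lemma norm_secondVector (hN : 0 < N) (hz : 0 < z) : ‖secondVector N p q z‖ = 1 := by
  have hN' : (0 : ℝ) < N := by exact_mod_cast hN
  have h0 := meanDegree_pos (p := p) (q := q) hz 0
  have h1 := meanDegree_pos (p := p) (q := q) hz 1
  rw [← sq_eq_sq₀ (norm_nonneg _) zero_le_one, EuclideanSpace.real_norm_sq_eq]
  simp only [secondVector, div_pow]
  rw [sum_node fun c => separator p q z c ^ 2 / √N ^ 2]
  simp only [separator, div_pow, if_true, one_ne_zero, if_false, neg_sq]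
  rw [Real.sq_sqrt h0.le, Real.sq_sqrt h1.le, Real.sq_sqrt (by positivity), Real.sq_sqrt hN'.le]
  field_simp
  ring

lemma inner_topVector_secondVector : ⟪topVector N p q z, secondVector N p q z⟫ = 0 := by
  simp only [PiLp.inner_apply, topVector, secondVector, RCLike.inner_apply, conj_trivial]
  rw [sum_node fun c => separator p q z c / √N *
    (√(meanDegree p q z c) / √(N * (meanDegree p q z 0 + meanDegree p q z 1)))]
  simp only [separator, if_true, one_ne_zero, if_false]
  ring

/-- The matrix is constant on blocks, hence acts as a symmetric 2 × 2 matrix. It fixes the vector of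
square roots of the mean degrees, and the trace gives the other eigenvalue `p/(p+z) + q/(q+z) - 1 =
secondValue p q z`. -/
lemma meanNormalized_eq (hN : 0 < N) (hz : 0 < z) :
    meanInvSqrt N p q z * meanAdj N p q z * meanInvSqrt N p q z =
      vecMulVec (topVector N p q z) (topVector N p q z) +
        secondValue p q z • vecMulVec (secondVector N p q z) (secondVector N p q z) := by
  have hN' : (0 : ℝ) < N := by exact_mod_cast hN
  have h0 := meanDegree_pos (p := p) (q := q) hz 0
  have h1 := meanDegree_pos (p := p) (q := q) hz 1
  have e0 : meanDegree p q z 0 = p + z := by simp [meanDegree, rate]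
  have e1 : meanDegree p q z 1 = q + z := by simp [meanDegree, rate]
  have hs0 := Real.sqrt_pos.2 h0
  have hs1 := Real.sqrt_pos.2 h1
  have hsN := Real.sqrt_pos.2 hN'
  have hsS := Real.sqrt_pos.2 (add_pos h0 h1)
  have q0 := Real.sq_sqrt h0.le
  have q1 := Real.sq_sqrt h1.le
  have qN := Real.sq_sqrt hN'.le
  have qS := Real.sq_sqrt (add_pos h0 h1).le
  ext u w
  simp only [meanInvSqrt, Matrix.mul_diagonal, Matrix.diagonal_mul, Matrix.add_apply,
    Matrix.smul_apply, vecMulVec_apply, smul_eq_mul, meanAdj, Matrix.of_apply, edgeProb_mk,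
    topVector, secondVector, separator, Real.sqrt_mul hN'.le]
  generalize label u = a
  generalize label w = b
  -- Everything is expressed through the square roots, so that each block becomes a rational
  -- identity modulo `s² = x² + y²`.
  have hp : (p : ℝ) = √(meanDegree p q z 0) ^ 2 - z := by rw [q0, e0]; ring
  have hq : (q : ℝ) = √(meanDegree p q z 1) ^ 2 - z := by rw [q1, e1]; ring
  have hS : √(meanDegree p q z 0 + meanDegree p q z 1) ^ 2 =
      √(meanDegree p q z 0) ^ 2 + √(meanDegree p q z 1) ^ 2 := by rw [qS, q0, q1]
  have hval : secondValue p q z = ((√(meanDegree p q z 0) ^ 2 - z) *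
      (√(meanDegree p q z 1) ^ 2 - z) - (z : ℝ) ^ 2) /
        (√(meanDegree p q z 0) ^ 2 * √(meanDegree p q z 1) ^ 2) := by
    rw [← hp, ← hq, q0, q1, secondValue]
  rw [hval]
  fin_cases a <;> fin_cases b <;>
    simp only [Fin.zero_eta, Fin.mk_one, rate, if_true, one_ne_zero, zero_ne_one, if_false,
      hp, hq] <;>
    clear hval hp hq q0 q1 qS qN e0 e1 <;>
    generalize √(meanDegree p q z 0 + meanDegree p q z 1) = s at * <;>
    generalize √(meanDegree p q z 0) = x at * <;>
    generalize √(meanDegree p q z 1) = y at * <;>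
    generalize √(N : ℝ) = n at * <;>
    field_simp <;> rw [hS] <;> ring

end SBM
-- The second eigenvector and the crops of a typical graph
namespace SBM

open MeasureTheory ProbabilityTheory Matrix
open scoped Matrix.Norms.L2Operator RealInnerProductSpace

variable {N : ℕ} {p q z : unitInterval}

lemma one_le_abs_separator_sub (hz : 0 < z) : 1 ≤ |separator p q z 0 - separator p q z 1| := by
  have h0 := meanDegree_pos (p := p) (q := q) hz 0
  have h1 := meanDegree_pos (p := p) (q := q) hz 1
  refine le_trans ?_ (le_abs_self _)
  simp only [separator, if_true, one_ne_zero, if_false]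
  rw [← sub_div, one_le_div (Real.sqrt_pos.2 (add_pos h0 h1)), sub_neg_eq_add, add_comm]
  rw [Real.sqrt_le_iff]
  refine ⟨by positivity, ?_⟩
  rw [add_sq, Real.sq_sqrt h0.le, Real.sq_sqrt h1.le]
  linarith [mul_nonneg (Real.sqrt_nonneg (meanDegree p q z 0))
    (Real.sqrt_nonneg (meanDegree p q z 1))]

lemma normalized_mulVec_vector {G : Graph N} (S : Eigensystem G) (j : Fin (2 * N)) :
    (invSqrtDegree G * adj G * invSqrtDegree G) *ᵥ ⇑(S.vector j) =
      (1 - S.value j) • ⇑(S.vector j) := by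
  have h := S.mulVec_vector j
  rw [laplacian, Matrix.sub_mulVec, Matrix.one_mulVec] at h
  rw [sub_smul, one_smul, ← h, sub_sub_cancel]

/-- The relative squared error of the second eigenvector of a typical graph. -/
noncomputable def errorConst (p q z : unitInterval) : ℝ :=
  200 / (z : ℝ) ^ 4 * (1 / secondValue p q z ^ 2 + 1 / (1 - secondValue p q z) ^ 2)

theorem IsTypical.exists_sign_sum_sq_le {δ : ℝ} {G : Graph N} (h : IsTypical p q z δ G)
    (hN : 2 ≤ N) (hz : 0 < z) (hzq : z < q) (hqp : q < p) (hδ : 2 * δ ≤ z) (hδ₀ : 0 ≤ δ)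
    (hδ₁ : 5 * δ / (z : ℝ) ^ 2 ≤ secondValue p q z / 2)
    (hδ₂ : errorConst p q z * δ ^ 2 < 1) (S : Eigensystem G) :
    ∃ s : ℝ, s ^ 2 = 1 ∧
      ∑ w, (S.vector ⟨1, by lia⟩ w - s * (separator p q z (label w) / √N)) ^ 2 ≤
        errorConst p q z * δ ^ 2 := by
  have hN' : 0 < N := by omega
  have hz' : (0 : ℝ) < z := hz
  have hM := h.norm_normalized_sub_le hN' hz hzq.le hqp.le hδ hδ₀
  rw [meanNormalized_eq hN' hz] at hM
  set M := invSqrtDegree G * adj G * invSqrtDegree G with hM_def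
  set e₁ := topVector N p q z
  set e₂ := secondVector N p q z
  set ρ := secondValue p q z
  -- `200 = 8 · 5²`, from the perturbation bound and the `5δ/z²` of the normalized matrix.
  have herr : errorConst p q z * δ ^ 2 =
      8 * (5 * δ / (z : ℝ) ^ 2) ^ 2 * (1 / ρ ^ 2 + 1 / (1 - ρ) ^ 2) := by
    rw [errorConst]; ring
  have happly : ∀ x : EuclideanSpace ℝ (Node N), Matrix.toEuclideanLin M x -
      (⟪e₁, x⟫ • e₁ + (ρ * ⟪e₂, x⟫) • e₂) = (EuclideanSpace.equiv (Node N) ℝ).symm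
        ((M - (vecMulVec e₁ e₁ + ρ • vecMulVec e₂ e₂)) *ᵥ x) := by
    intro x
    ext w
    simp [Matrix.sub_mulVec, Matrix.add_mulVec, Matrix.smul_mulVec, Matrix.vecMulVec_mulVec,
      PiLp.inner_apply, dotProduct, Matrix.toLpLin_apply]
    simp only [mul_comm (x.ofLp _)]
    ring
  obtain ⟨s, hs, hle⟩ := exists_sign_norm_sub_le (b := S.vector) (T := Matrix.toEuclideanLin M)
    (m := fun j => 1 - S.value j) (i₀ := ⟨0, by lia⟩) (i₁ := ⟨1, by lia⟩)
    (δ := 5 * δ / (z : ℝ) ^ 2)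
    (norm_topVector hN' hz) (norm_secondVector hN' hz) inner_topVector_secondVector
    (secondValue_pos hz hzq hqp) (secondValue_lt_one hz)
    (fun j => by
      ext w
      exact congrFun (normalized_mulVec_vector S j) w)
    (by simp) (sub_le_sub_left (S.monotone_value (by simp [Fin.le_def])) _)
    (fun j hj => sub_le_sub_left (S.monotone_value (by
      rw [Fin.le_def]
      have : (j : ℕ) ≠ 0 := fun h0 => hj (Fin.ext h0)
      simp; omega)) _)
    (fun x => by
      rw [happly]
      exact (l2_opNorm_mulVec _ x).trans (mul_le_mul_of_nonneg_right hM (norm_nonneg x)))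
    hδ₁ (by linarith)
  refine ⟨s, hs, ?_⟩
  rw [herr]
  refine le_trans (le_of_eq ?_) hle
  rw [EuclideanSpace.real_norm_sq_eq]
  rfl

/-- In a typical graph, the spectral crop of all nodes but few has the right majority. -/
theorem IsTypical.card_majority_crop_ne_le {δ : ℝ} {G : Graph N} (h : IsTypical p q z δ G)
    (hN : 2 ≤ N) (hz : 0 < z) (hzq : z < q) (hqp : q < p) (hδ : 2 * δ ≤ z) (hδ₀ : 0 ≤ δ)
    (hδ₁ : 5 * δ / (z : ℝ) ^ 2 ≤ secondValue p q z / 2)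
    (hδ₂ : errorConst p q z * δ ^ 2 < 1) (S : Eigensystem G) {K : ℕ} (hK : 0 < K) :
    ((Finset.univ.filter fun v =>
        majority (crop S hN ((1 / 2 : ℝ) / √(N : ℝ)) v) ≠ some (label v)).card : ℝ) ≤
      (64 * (errorConst p q z * δ ^ 2) * (16 * K + 3) + 1 / K ^ 2) * N := by
  have hsN : 0 < √(N : ℝ) := Real.sqrt_pos.2 (by exact_mod_cast (by omega : 0 < N))
  obtain ⟨s, hs, hsum⟩ := h.exists_sign_sum_sq_le hN hz hzq hqp hδ hδ₀ hδ₁ hδ₂ S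
  have hfar := (card_far_le (S.vector ⟨1, by lia⟩) _).trans
    (mul_le_mul_of_nonneg_left hsum (by positivity : (0 : ℝ) ≤ 64 * N))
  have hcancel : ∀ w : Node N, √N * (s * (separator p q z (label w) / √N)) =
      s * separator p q z (label w) := fun w => by field_simp
  simp only [hcancel] at hfar
  set W : Finset (Node N) := Finset.univ.filter fun w =>
    |√N * S.vector ⟨1, by lia⟩ w - s * separator p q z (label w)| ≤ 1 / 8 with hW
  have hWc : Wᶜ = Finset.univ.filter fun w => (1 / 8 : ℝ) <
      |√N * S.vector ⟨1, by lia⟩ w - s * separator p q z (label w)| := by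
    ext w; simp [hW]
  rw [← hWc] at hfar
  refine (SBM.card_majority_crop_ne_le S hN (fun c => s * separator p q z c) ?_ W
    (fun w hw => (Finset.mem_filter.1 hw).2) hK).trans ?_
  · have hs1 : |s| = 1 := by rw [← Real.sqrt_sq_eq_abs, hs, Real.sqrt_one]
    rw [← mul_sub, abs_mul, hs1, one_mul]
    exact one_le_abs_separator_sub hz
  · have h1 := mul_le_mul_of_nonneg_right hfar (by positivity : (0 : ℝ) ≤ 16 * K + 3)
    refine (add_le_add_left h1 _).trans (le_of_eq ?_)
    ring

end SBM
-- Probability estimates and conclusion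
namespace SBM

open MeasureTheory ProbabilityTheory Matrix Filter Topology

variable {N : ℕ} {p q z : unitInterval}

lemma exp_neg_le_two_div_sq {t : ℝ} (ht : 0 < t) : Real.exp (-t) ≤ 2 / t ^ 2 := by
  have h := Real.pow_div_factorial_le_exp t ht.le 2
  rw [Real.exp_neg, ← inv_div]
  exact inv_anti₀ (by positivity) (by simpa using h)

theorem measure_not_isTypical_le {δ : ℝ} (hδ : 0 < δ) (hN : 0 < N) :
    (law N p q z).real {G | ¬ IsTypical p q z δ G} ≤ 44 / (δ ^ 4 * N) := by
  have hN' : (0 : ℝ) < N := by exact_mod_cast hN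
  have hsub : {G : Graph N | ¬ IsTypical p q z δ G} ⊆
      {G | δ * N < (open scoped Matrix.Norms.L2Operator in ‖noiseMatrix p q z G‖)} ∪
        ⋃ x : Node N × Fin 2, {G | δ * N < |∑ i : Fin N, noise p q z G s(x.1, (x.2, i))|} := by
    intro G hG
    by_contra hcon
    rw [Set.mem_union, not_or, Set.mem_iUnion, not_exists] at hcon
    exact hG ⟨not_lt.1 hcon.1, fun u c => not_lt.1 (hcon.2 (u, c))⟩
  have hexp : Real.exp (-(2 * δ ^ 2) * N) ≤ 2 / (2 * δ ^ 2 * N) ^ 2 := by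
    rw [neg_mul]
    exact exp_neg_le_two_div_sq (by positivity)
  calc _ ≤ _ := measureReal_mono hsub
    _ ≤ _ := measureReal_union_le _ _
    _ ≤ 40 / (δ ^ 4 * N) + ∑ _x : Node N × Fin 2, 2 * (2 / (2 * δ ^ 2 * N) ^ 2) :=
        add_le_add (measure_norm_noiseMatrix_gt_le hδ hN)
          ((measureReal_iUnion_fintype_le _).trans (Finset.sum_le_sum fun x _ =>
            (measure_sum_noise_ge_le x.1 x.2 hδ).trans
              (mul_le_mul_of_nonneg_left hexp zero_le_two)))
    -- The `4N` degree events cost `1/(δ⁴N²)` each.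
    _ = 44 / (δ ^ 4 * N) := by
        simp only [Finset.sum_const, Finset.card_univ, Fintype.card_prod, Fintype.card_fin,
          nsmul_eq_mul]
        push_cast
        field_simp
        norm_num

lemma measureReal_prod_le_of_forall_mem {α β : Type*} [MeasurableSpace α] [MeasurableSpace β]
    {μ : Measure α} {ν : Measure β} [IsProbabilityMeasure μ] [IsProbabilityMeasure ν]
    {F : Set (α × β)} (hF : MeasurableSet F) {T : Set α} (hT : MeasurableSet T) {η : ℝ}
    (hη : 0 ≤ η) (h : ∀ a ∈ T, ν.real {b | (a, b) ∈ F} ≤ η) :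
    (μ.prod ν).real F ≤ μ.real Tᶜ + η := by
  have hle : (μ.prod ν) F ≤ μ Tᶜ + ENNReal.ofReal η := by
    rw [Measure.prod_apply hF]
    calc ∫⁻ a, ν (Prod.mk a ⁻¹' F) ∂μ
        ≤ ∫⁻ a, (Tᶜ.indicator 1 a + ENNReal.ofReal η) ∂μ := by
          refine lintegral_mono fun a => ?_
          by_cases ha : a ∈ T
          · refine le_add_of_nonneg_of_le (zero_le) ?_
            rw [← ofReal_measureReal]
            exact ENNReal.ofReal_le_ofReal (h a ha)
          · rw [Set.indicator_of_mem (by exact ha)]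
            exact le_add_of_le_of_nonneg prob_le_one (zero_le)
      _ = μ Tᶜ + ENNReal.ofReal η := by
          rw [lintegral_add_right _ measurable_const, lintegral_indicator_one hT.compl,
            lintegral_const, measure_univ, mul_one]
  have h2 := ENNReal.toReal_mono (by finiteness) hle
  rwa [ENNReal.toReal_add (by finiteness) (by finiteness), ENNReal.toReal_ofReal hη] at h2

lemma real_uniformOn_univ_setOf {V : Type*} [Fintype V] [MeasurableSpace V]
    [MeasurableSingletonClass V] (P : V → Prop) [DecidablePred P] :
    (uniformOn (Set.univ : Set V)).real {v | P v} =
      (Finset.univ.filter P).card / Fintype.card V := by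
  have h : {v | P v} = ((Finset.univ.filter P : Finset V) : Set V) := by ext; simp
  rw [measureReal_def, uniformOn_univ, h, Measure.count_apply_finset]
  simp

/-- The event that the ego networks up to radius `1` and the spectral crop of radius
`1 / (2 √N)` all have the label of the node as their majority. -/
def goodEvent (hN : 2 ≤ N) (S : ∀ G : Graph N, Eigensystem G) : Set (Graph N × Node N) :=
  {x | ∀ k : ℕ, k ≤ 1 →
    majority (ego x.1 k x.2) = majority (crop (S x.1) hN ((1 / 2 : ℝ) / √(N : ℝ)) x.2) ∧
      majority (crop (S x.1) hN ((1 / 2 : ℝ) / √(N : ℝ)) x.2) = some (label x.2)}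

instance [NeZero N] : IsProbabilityMeasure (jointLaw N p q z) := by
  have := isProbabilityMeasure_uniformOn (Set.finite_univ (α := Node N)) Set.univ_nonempty
  unfold jointLaw
  infer_instance

theorem eventually_one_sub_le_goodEvent (hz : 0 < z) (hzq : z < q) (hqp : q < p) {ε : ℝ}
    (hε : 0 < ε) : ∃ N₀ : ℕ, ∀ (N : ℕ) (hN : 2 ≤ N) (S : ∀ G : Graph N, Eigensystem G),
      N₀ ≤ N → 1 - ε ≤ (jointLaw N p q z).real (goodEvent hN S) := by
  classical
  have hz' : (0 : ℝ) < z := hz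
  have hzq' : (z : ℝ) < q := hzq
  -- The order of choices matters: `K` depends on `ε`, `δ` on `K`, and `N₀` on `δ`; none of them
  -- depends on the eigenbases.
  obtain ⟨K, hK⟩ := exists_nat_gt (max 1 (4 / ε))
  have hK1 : (1 : ℝ) < K := (le_max_left _ _).trans_lt hK
  have hKε : 1 / (K : ℝ) ^ 2 ≤ ε / 4 := by
    have h1 : 4 / ε < K := (le_max_right _ _).trans_lt hK
    rw [div_lt_iff₀ hε] at h1
    rw [div_le_iff₀ (by positivity)]
    nlinarith [mul_pos (show (0 : ℝ) < K by linarith) hε]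
  have hsmall : ∀ (f : ℝ → ℝ) (c : ℝ), Continuous f → f 0 < c → ∀ᶠ δ in 𝓝[>] (0 : ℝ), f δ < c :=
    fun f c hf h => (((hf.tendsto 0).eventually_lt_const h).filter_mono nhdsWithin_le_nhds)
  obtain ⟨δ, hδ₀, hδz, hδq, hδ₁, hδ₂, hδK⟩ : ∃ δ : ℝ, 0 < δ ∧ 2 * δ < z ∧ 2 * δ < q - z ∧
      5 * δ / (z : ℝ) ^ 2 < secondValue p q z / 2 ∧ errorConst p q z * δ ^ 2 < 1 ∧
      64 * (errorConst p q z * δ ^ 2) * (16 * K + 3) < ε / 4 := by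
    have hρ := secondValue_pos hz hzq hqp
    have h1 := hsmall (fun δ => 2 * δ) z (by fun_prop) (by simpa using hz')
    have h2 := hsmall (fun δ => 2 * δ) (q - z) (by fun_prop) (by simpa using hzq')
    have h3 := hsmall (fun δ => 5 * δ / (z : ℝ) ^ 2) (secondValue p q z / 2) (by fun_prop)
      (by simpa using hρ)
    have h4 := hsmall (fun δ => errorConst p q z * δ ^ 2) 1 (by fun_prop) (by simp)
    have h5 := hsmall (fun δ => 64 * (errorConst p q z * δ ^ 2) * (16 * K + 3)) (ε / 4)
      (by fun_prop) (by simpa using hε)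
    have h0 : ∀ᶠ δ in 𝓝[>] (0 : ℝ), 0 < δ := self_mem_nhdsWithin
    exact (h0.and (h1.and (h2.and (h3.and (h4.and h5))))).exists
  obtain ⟨N₀, hN₀⟩ := exists_nat_gt (44 / (δ ^ 4 * (ε / 2)))
  refine ⟨N₀, fun N hN S hle => ?_⟩
  have : NeZero N := ⟨by omega⟩
  have hN' : (0 : ℝ) < N := by exact_mod_cast (by omega : 0 < N)
  have hprob : (law N p q z).real {G | ¬ IsTypical p q z δ G} ≤ ε / 2 := by
    refine (measure_not_isTypical_le hδ₀ (by omega)).trans ?_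
    have h1 : 44 / (δ ^ 4 * (ε / 2)) < N := hN₀.trans_le (by exact_mod_cast hle)
    rw [div_lt_iff₀ (by positivity)] at h1
    rw [div_le_iff₀ (by positivity)]
    linarith
  have hbad : ∀ G : Graph N, IsTypical p q z δ G →
      (uniformOn (Set.univ : Set (Node N))).real {v | (G, v) ∈ (goodEvent hN S)ᶜ} ≤ ε / 2 := by
    intro G hG
    have hsub : {v | (G, v) ∈ (goodEvent hN S)ᶜ} ⊆
        {v | majority (crop (S G) hN ((1 / 2 : ℝ) / √(N : ℝ)) v) ≠ some (label v)} := by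
      intro v hv hcon
      refine hv fun k hk => ⟨?_, hcon⟩
      rw [hcon]
      interval_cases k
      · exact majority_ego_zero G v
      · exact hG.majority_ego_one (by omega) hqp.le hδq v
    have hP := isProbabilityMeasure_uniformOn (Set.finite_univ (α := Node N)) Set.univ_nonempty
    refine (measureReal_mono hsub).trans ?_
    rw [real_uniformOn_univ_setOf]
    have hcard : (Fintype.card (Node N) : ℝ) = 2 * N := by simp
    rw [hcard, div_le_iff₀ (by positivity)]
    refine (hG.card_majority_crop_ne_le hN hz hzq hqp hδz.le hδ₀.le hδ₁.le hδ₂ (S G)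
      (by exact_mod_cast zero_lt_one.trans hK1)).trans ?_
    nlinarith
  have hcompl := measureReal_prod_le_of_forall_mem (μ := law N p q z)
    (ν := uniformOn (Set.univ : Set (Node N))) (F := (goodEvent hN S)ᶜ)
    (T := {G | IsTypical p q z δ G}) (Set.toFinite _).measurableSet
    (Set.toFinite _).measurableSet (by positivity) hbad
  have heq : (jointLaw N p q z).real (goodEvent hN S)ᶜ =
      1 - (jointLaw N p q z).real (goodEvent hN S) :=
    probReal_compl_eq_one_sub (Set.toFinite _).measurableSet
  have hT : (law N p q z).real {G | IsTypical p q z δ G}ᶜ ≤ ε / 2 := hprob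
  rw [jointLaw] at heq ⊢
  linarith

end SBM

theorem theorem1 (p q z : unitInterval) (hz : 0 < z) (hzq : z < q) (hqp : q < p) :
    ∃ c : ℝ, 0 < c ∧ ∃ kmax : ℕ, 1 ≤ kmax ∧
      ∃ f : ℕ → ℝ, Filter.Tendsto f Filter.atTop (nhds 0) ∧
        ∀ (N : ℕ) (hN : 2 ≤ N) (S : ∀ G : SBM.Graph N, SBM.Eigensystem G),
          1 - f N ≤ (SBM.jointLaw N p q z).real
            {x : SBM.Graph N × SBM.Node N | ∀ k : ℕ, k ≤ kmax →
              SBM.majority (SBM.ego x.1 k x.2) =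
                  SBM.majority (SBM.crop (S x.1) hN (c / √(N : ℝ)) x.2) ∧
                SBM.majority (SBM.crop (S x.1) hN (c / √(N : ℝ)) x.2) =
                  some (SBM.label x.2)} := by
  -- `f N` is the supremum of the failure probability over all choices of eigenbases, which makes it
  -- independent of the choice.
  refine ⟨1 / 2, by norm_num, 1, le_rfl, fun N => if hN : 2 ≤ N then
    ⨆ S : ∀ G : SBM.Graph N, SBM.Eigensystem G,
      (1 - (SBM.jointLaw N p q z).real (SBM.goodEvent hN S)) else 0, ?_, ?_⟩
  · rw [Metric.tendsto_atTop]
    intro ε hε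
    obtain ⟨N₀, hN₀⟩ := SBM.eventually_one_sub_le_goodEvent hz hzq hqp (half_pos hε)
    refine ⟨N₀, fun N hle => ?_⟩
    rw [Real.dist_0_eq_abs]
    split_ifs with hN
    · have : NeZero N := ⟨by omega⟩
      have h0 := Real.iSup_nonneg (f := fun S : ∀ G : SBM.Graph N, SBM.Eigensystem G =>
        1 - (SBM.jointLaw N p q z).real (SBM.goodEvent hN S))
        fun S => sub_nonneg.2 MeasureTheory.measureReal_le_one
      rw [abs_of_nonneg h0]
      refine (Real.iSup_le (fun S => ?_) (half_pos hε).le).trans_lt (half_lt_self hε)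
      linarith [hN₀ N hN S hle]
    · simpa using hε
  · intro N hN S
    simp only [dif_pos hN]
    have hbdd : BddAbove (Set.range fun S : ∀ G : SBM.Graph N, SBM.Eigensystem G =>
        1 - (SBM.jointLaw N p q z).real (SBM.goodEvent hN S)) :=
      ⟨1, by rintro _ ⟨S, rfl⟩; exact sub_le_self _ MeasureTheory.measureReal_nonneg⟩
    have h := le_ciSup hbdd S
    rw [sub_le_comm]
    exact h
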